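/- Let $\mathbb F_q$ be a finite field with $q$ elements, let $G=\mathrm{GL}_2(\mathbb F_q)$, and let all representations be complex. Write $\widehat{\mathbb F_q^\times}$ for the set of homomorphisms $\mathbb F_q^\times\to\mathbb C^\times$ and $\mathbb 1_q$ for the trivial one. Let $P=\left\{\begin{pmatrix}1&y\\0&w\end{pmatrix}: y\in\mathbb F_q,\ w\in\mathbb F_q^\times\right\}$ and let $B$ be the subgroup of all upper triangular matrices in $G$. For $\mu_1,\mu_2\in\widehat{\mathbb F_q^\times}$ let $\rho_{\mu_1,\mu_2}=\mathrm{Ind}_B^G(\mu_{1,2})$, where $\mu_{1,2}\begin{pmatrix}u&w\\0&v\end{pmatrix}=\mu_1(u)\mu_2(v)$. The trivial representation $\mathbb 1_G$ is isomorphic to a subrepresentation of $\rho_{\mathbb 1_q,\mathbb 1_q}$ and has an invariant complement in it; let $\rho_{\mathbb 1_q}$ denote any such complement. Then $$\mathrm{Ind}_P^{G}(\mathbb 1_P)\;\cong\;\mathbb 1_G\;\oplus\;\rho_{\mathbb 1_q}\;\oplus\bigoplus_{\chi\in\widehat{\mathbb F_q^\times},\ \chi\ne\mathbb 1_q}\rho_{\chi,\mathbb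 1_q},$$ and the representations $\mathbb 1_G$, $\rho_{\mathbb 1_q}$ and $\rho_{\chi,\mathbb 1_q}$ ($\chi\neq\mathbb 1_q$) are irreducible and pairwise inequivalent. -/

import Mathlib

open scoped MatrixGroups

namespace GLTwo

noncomputable section

/-- The induced representation `Ind_H^G σ` of a finite group `G`, in its function model: the space
of all `f : G → V` with `f (h * x) = σ h (f x)` for `h ∈ H`, on which `G` acts by right
translation, `(g • f) x = f (x * g)`. -/
abbrev induced {G : Type*} [Group G] (H : Subgroup G) {V : Type*} [AddCommGroup V] [Module ℂ V]
    (σ : Representation ℂ H V) : Representation ℂ G (Representation.coindV H.subtype σ) :=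
  Representation.coind H.subtype σ

/-- For a finite group, the function model agrees with the tensor product model
`Representation.ind` of the induced representation. -/
theorem ind_equiv_induced {G : Type*} [Group G] [Finite G] (H : Subgroup G)
    {V : Type} [AddCommGroup V] [Module ℂ V] (σ : Representation ℂ H V) :
    Nonempty ((Representation.ind H.subtype σ).Equiv (induced H σ)) := by
  classical
  let e := Rep.indCoindIso.{0} (Rep.of σ)
  exact ⟨Representation.equivOfIso e⟩

/-- The one-dimensional complex representation, on the space `ℂ`, given by a multiplicative
character: `g` acts on `ℂ` as multiplication by `χ g`. -/
def charRep {G : Type*} [Group G] (χ : G →* ℂˣ) : Representation ℂ G ℂ :=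
  (Algebra.lmul ℂ ℂ).toMonoidHom.comp ((Units.coeHom ℂ).comp χ)

theorem charRep_apply {G : Type*} [Group G] (χ : G →* ℂˣ) (g : G) (z : ℂ) :
    charRep χ g z = (χ g : ℂ) * z := rfl

variable (F : Type*) [Field F]

theorem inv_one_zero {g : GL (Fin 2) F} (hg : g 1 0 = 0) : g⁻¹ 1 0 = 0 := by
  rw [Matrix.coe_units_inv, Matrix.inv_def, Matrix.adjugate_fin_two]
  simp [hg]

/-- The Borel subgroup `B` of `GL₂(F)`: all upper triangular matrices `[[u, w], [0, v]]`. -/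
def borel : Subgroup (GL (Fin 2) F) where
  carrier := {g | g 1 0 = 0}
  mul_mem' {a b} ha hb := by
    simp only [Set.mem_ofPred_eq] at ha hb ⊢
    simp [Matrix.mul_apply, Fin.sum_univ_two, ha, hb]
  one_mem' := by simp
  inv_mem' {a} ha := inv_one_zero F ha

/-- The mirabolic subgroup `P` of `GL₂(F)`: all matrices `[[1, y], [0, w]]`. -/
def mirabolic : Subgroup (GL (Fin 2) F) where
  carrier := {g | g 0 0 = 1 ∧ g 1 0 = 0}
  mul_mem' {a b} ha hb := by
    simp only [Set.mem_ofPred_eq] at ha hb ⊢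
    simp [Matrix.mul_apply, Fin.sum_univ_two, ha.1, ha.2, hb.1, hb.2]
  one_mem' := by simp
  inv_mem' {a} ha := by
    have h10 := inv_one_zero F ha.2
    refine ⟨?_, h10⟩
    have h : (a⁻¹ * a : GL (Fin 2) F) 0 0 = 1 := by simp
    rw [Units.val_mul, Matrix.mul_apply, Fin.sum_univ_two, ha.1, ha.2] at h
    simpa using h

variable {F}

theorem borel_diag_mul {g : GL (Fin 2) F} (hg : g ∈ borel F) : g 0 0 * g 1 1 ≠ 0 := by
  have h10 : g 1 0 = 0 := hg
  have h := (Matrix.GeneralLinearGroup.det g).ne_zero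
  rw [Matrix.GeneralLinearGroup.val_det_apply, Matrix.det_fin_two, h10] at h
  simpa using h

/-- The character `[[u, w], [0, v]] ↦ μ₁ u * μ₂ v` of the Borel subgroup. -/
def borelChar (μ₁ μ₂ : Fˣ →* ℂˣ) : borel F →* ℂˣ where
  toFun b :=
    μ₁ (Units.mk0 (b.1 0 0) (left_ne_zero_of_mul (borel_diag_mul b.2))) *
      μ₂ (Units.mk0 (b.1 1 1) (right_ne_zero_of_mul (borel_diag_mul b.2)))
  map_one' := by
    have h1 : ∀ h, Units.mk0 ((1 : borel F).1 0 0) h = 1 := fun h => Units.ext (by simp)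
    have h2 : ∀ h, Units.mk0 ((1 : borel F).1 1 1) h = 1 := fun h => Units.ext (by simp)
    rw [h1, h2, map_one, map_one, one_mul]
  map_mul' a b := by
    have ha : a.1 1 0 = 0 := a.2
    have hb : b.1 1 0 = 0 := b.2
    rw [mul_mul_mul_comm, ← map_mul, ← map_mul]
    congr 2 <;> ext <;> simp [Matrix.mul_apply, Fin.sum_univ_two, ha, hb]

/-- The representation `ρ_{μ₁, μ₂} = Ind_B^G μ_{1,2}` of `G = GL₂(F)`. -/
abbrev principalSeries (μ₁ μ₂ : Fˣ →* ℂˣ) :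
    Representation ℂ (GL (Fin 2) F)
      (Representation.coindV (borel F).subtype (charRep (borelChar μ₁ μ₂))) :=
  induced (borel F) (charRep (borelChar μ₁ μ₂))

/-- The one-dimensional representation `det_μ : g ↦ μ (det g)` of `GL₂(F)`. -/
def detRep (μ : Fˣ →* ℂˣ) : Representation ℂ (GL (Fin 2) F) ℂ :=
  charRep (μ.comp Matrix.GeneralLinearGroup.det)

/-- `W` is a complement of `det_μ` in `ρ_{μ, μ}`: the representation `ρ_{μ, μ}` is the internal
direct sum of `W` and of a subrepresentation isomorphic to `det_μ`. The representation of `GL₂(F)`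
on such a `W` is what is denoted `ρ_μ`. -/
def IsDetComplement (μ : Fˣ →* ℂˣ) (W : Subrepresentation (principalSeries μ μ)) : Prop :=
  ∃ D : Subrepresentation (principalSeries μ μ),
    Nonempty (D.toRepresentation.Equiv (detRep μ)) ∧ IsCompl D W

end

end GLTwo

namespace GLTwo

noncomputable section

open Representation

/-! ### Representations induced from a character of a subgroup -/

section Induced

variable {G : Type*} [Group G] {H : Subgroup G} {ψ : H →* ℂˣ}

/-! Since diag(a, 1) normalises `P`, left translation by these matrices is an action of `Fˣ` on
`Ind_P^G 1` commuting with `G`. As `B` is generated by `P` and the diag(a, 1), the `χ`-eigenspace is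
`ρ_{χ,1}`. Fourier inversion on `Fˣ` (`projMirabolic_inclMirabolic_self`,
`projMirabolic_inclMirabolic_of_ne`, `sum_inclMirabolic_projMirabolic`) gives the sum of all
`ρ_{χ,1}`, and the term `χ = 1` splits further into constants and `W`.

Irreducibility rests on two facts about `Ind_H^G ψ`: the function `e = extendChar ψ` generates it
(`eq_top_of_extendChar_mem`), and every nonzero subrepresentation contains some `h` with `h 1 = 1`
that transforms by `ψ` under `H` on both sides (`exists_biequivariant_mem`). For `H = B` there are
only the double cosets of 1 and of the Weyl element, so `h` is determined by its value at `weyl`.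
That value is 0 when `μ₁ ≠ μ₂`, so `h = e`; in `ρ_{1,1}`, `h` is a constant plus a multiple of `e`,
which is enough modulo constants.

Central characters give the inequivalences: the scalar `a` acts on `ρ_{χ,1}` by `χ a`, and trivially
on `1_G` and `W`. These last two differ because invariant functions are constant and `W` contains no
nonzero constant. -/

theorem coindV_charRep_apply (f : coindV H.subtype (charRep ψ)) (b : H) (x : G) :
    f.1 (b * x) = ψ b * f.1 x :=
  f.2 b x

theorem coindV_trivial_apply (f : coindV H.subtype (Representation.trivial ℂ H ℂ)) (b : H)
    (x : G) : f.1 (b * x) = f.1 x :=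
  f.2 b x

theorem induced_apply {V : Type*} [AddCommGroup V] [Module ℂ V] {σ : Representation ℂ H V}
    (g : G) (f : coindV H.subtype σ) (x : G) : (induced H σ g f).1 x = f.1 (x * g) :=
  rfl

open Classical in
/-- The element of `Ind_H^G ψ` supported on `H` with value `1` at `1`. -/
def extendChar (ψ : H →* ℂˣ) : coindV H.subtype (charRep ψ) :=
  ⟨fun x => if h : x ∈ H then (ψ ⟨x, h⟩ : ℂ) else 0, by
    intro b x
    by_cases h : x ∈ H
    · have h' : (b : G) * x ∈ H := H.mul_mem b.2 h
      have e : (⟨(b : G) * x, h'⟩ : H) = b * ⟨x, h⟩ := rfl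
      simp [h, h', charRep_apply, e]
    · have h' : (b : G) * x ∉ H := by rwa [H.mul_mem_cancel_left b.2]
      simp [h, h', charRep_apply]⟩

theorem extendChar_of_mem {x : G} (h : x ∈ H) : (extendChar ψ).1 x = ψ ⟨x, h⟩ := by
  simp [extendChar, h]

theorem extendChar_of_notMem {x : G} (h : x ∉ H) : (extendChar ψ).1 x = 0 := by
  simp [extendChar, h]

theorem extendChar_one : (extendChar ψ).1 1 = 1 := by
  rw [extendChar_of_mem H.one_mem]
  have : (⟨1, H.one_mem⟩ : H) = 1 := rfl
  simp [this]

theorem extendChar_ne_zero : extendChar ψ ≠ 0 := by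
  intro h
  have := extendChar_one (ψ := ψ)
  rw [h] at this
  simp at this

/-- The translate of `extendChar ψ` by `g⁻¹` is supported on the coset `H g`, so any `f` is the
combination of these translates with weights `f g`, each coset being counted `|H|` times. -/
theorem eq_top_of_extendChar_mem [Finite G] (M : Subrepresentation (induced H (charRep ψ)))
    (hM : extendChar ψ ∈ M.toSubmodule) : M = ⊤ := by
  classical
  have := Fintype.ofFinite G
  rw [eq_top_iff]
  intro f _
  change f ∈ M.toSubmodule
  have hc : (Nat.card H : ℂ) ≠ 0 := by
    exact_mod_cast Nat.card_pos.ne'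
  have key : f = (Nat.card H : ℂ)⁻¹ •
      ∑ g : G, f.1 g • induced H (charRep ψ) g⁻¹ (extendChar ψ) := by
    ext x
    simp only [Submodule.coe_smul, Submodule.coe_sum, Pi.smul_apply, Finset.sum_apply,
      induced_apply, smul_eq_mul]
    rw [eq_inv_mul_iff_mul_eq₀ hc]
    -- Substituting `g = h⁻¹ * x` turns the second factor into `extendChar ψ` at `h`, so only `h ∈
    -- H` contributes, each time `f x`.
    rw [← (((Equiv.inv G).trans (Equiv.mulRight x))).sum_comp]
    have : ∀ h : G, f.1 (((Equiv.inv G).trans (Equiv.mulRight x)) h) *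
        (extendChar ψ).1 (x * (((Equiv.inv G).trans (Equiv.mulRight x)) h)⁻¹) =
        if h ∈ H then f.1 x else 0 := by
      intro h
      simp only [Equiv.trans_apply, Equiv.inv_apply, Equiv.coe_mulRight, mul_inv_rev, inv_inv,
        mul_inv_cancel_left]
      split_ifs with hh
      · rw [extendChar_of_mem hh]
        have := coindV_charRep_apply f (⟨h, hh⟩⁻¹) x
        simp only [InvMemClass.coe_inv, map_inv] at this
        rw [this]
        have := (ψ ⟨h, hh⟩).ne_zero
        rw [Units.val_inv_eq_inv_val]
        field_simp
      · rw [extendChar_of_notMem hh, mul_zero]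
    rw [Finset.sum_congr rfl fun h _ => this h, Finset.sum_ite, Finset.sum_const_zero, add_zero,
      Finset.sum_const, nsmul_eq_mul, Nat.card_eq_fintype_card, Fintype.card_subtype]
  rw [key]
  exact M.toSubmodule.smul_mem _ (M.toSubmodule.sum_mem fun g _ =>
    M.toSubmodule.smul_mem _ (M.apply_mem_toSubmodule _ hM))

/-- Translate a nonzero `f` so that its value at 1 is nonzero, then project to the `ψ`-isotypic part
under right translation by `H`. The value at 1 survives because left equivariance cancels the
weights `ψ b⁻¹`. -/
theorem exists_biequivariant_mem [Finite G] (M : Subrepresentation (induced H (charRep ψ)))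
    (hM : M ≠ ⊥) : ∃ h ∈ M.toSubmodule, h.1 1 = 1 ∧
      ∀ (x : G) (b : H), h.1 (x * b) = ψ b * h.1 x := by
  have := Fintype.ofFinite H
  obtain ⟨f, hf, hf0⟩ : ∃ f ∈ M.toSubmodule, f ≠ 0 := by
    by_contra! hcon
    apply hM
    apply Subrepresentation.toSubmodule_injective
    exact (Submodule.eq_bot_iff _).2 hcon
  obtain ⟨y, hy⟩ : ∃ y, f.1 y ≠ 0 := by
    by_contra! hcon
    exact hf0 (Subtype.ext (funext hcon))
  have hc : (Fintype.card H : ℂ) ≠ 0 := by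
    exact_mod_cast Fintype.card_ne_zero
  refine ⟨(f.1 y * Fintype.card H)⁻¹ • ∑ b : H, ((ψ b)⁻¹ : ℂ) •
    induced H (charRep ψ) b (induced H (charRep ψ) y f), ?_, ?_, ?_⟩
  · exact M.toSubmodule.smul_mem _ (M.toSubmodule.sum_mem fun g _ =>
      M.toSubmodule.smul_mem _ (M.apply_mem_toSubmodule _ (M.apply_mem_toSubmodule _ hf)))
  · simp only [Submodule.coe_smul, Submodule.coe_sum, Pi.smul_apply, Finset.sum_apply,
      induced_apply, smul_eq_mul, one_mul, coindV_charRep_apply]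
    simp only [ne_eq, Units.ne_zero, not_false_eq_true, inv_mul_cancel_left₀, Finset.sum_const,
      Finset.card_univ, nsmul_eq_mul]
    field_simp
  · intro x c
    simp only [Submodule.coe_smul, Submodule.coe_sum, Pi.smul_apply, Finset.sum_apply,
      induced_apply, smul_eq_mul]
    rw [mul_left_comm]
    congr 1
    rw [Finset.mul_sum]
    refine Fintype.sum_equiv (Equiv.mulLeft c) _ _ fun b => ?_
    have := (ψ c).ne_zero
    simp only [Equiv.coe_mulLeft, map_mul, Units.val_mul, Subgroup.coe_mul, mul_assoc]
    field_simp

/-- For `a ≠ 1` some character is not 1 at `a`; multiplying by it permutes the sum and rescales it.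
-/
theorem sum_monoidHom_units_eq {A : Type*} [CommGroup A] [Finite A] [Fintype (A →* ℂˣ)]
    [DecidableEq A] (a : A) :
    ∑ χ : A →* ℂˣ, (χ a : ℂ) = if a = 1 then (Nat.card A : ℂ) else 0 := by
  have : NeZero (Monoid.exponent A) := ⟨Monoid.exponent_ne_zero_of_finite⟩
  split_ifs with ha
  · simp [ha, ← CommGroup.card_monoidHom_of_hasEnoughRootsOfUnity A ℂ]
  · obtain ⟨χ, hχ⟩ := CommGroup.exists_apply_ne_one_of_hasEnoughRootsOfUnity A ℂ ha
    refine eq_zero_of_mul_eq_self_left (b := (χ a : ℂ)) (by simpa using hχ) ?_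
    rw [Finset.mul_sum]
    exact Fintype.sum_bijective _ (Group.mulLeft_bijective χ) _ _ fun χ' => by simp

end Induced

/-! ### Matrix identities and the Bruhat decomposition -/

section GeneralLinear

variable {F : Type*} [Field F]

/-- The upper triangular matrix `[[u, w], [0, v]]`. -/
def upper (u v : Fˣ) (w : F) : borel F :=
  ⟨Matrix.GeneralLinearGroup.mkOfDetNeZero !![(u : F), w; 0, v] (by simp [Matrix.det_fin_two]),
    by change (_ : F) = 0; simp [Matrix.GeneralLinearGroup.mkOfDetNeZero]⟩

theorem coe_upper (u v : Fˣ) (w : F) :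
    ((upper u v w : GL (Fin 2) F) : Matrix (Fin 2) (Fin 2) F) = !![(u : F), w; 0, v] :=
  rfl

theorem borelChar_upper (μ₁ μ₂ : Fˣ →* ℂˣ) (u v : Fˣ) (w : F) :
    borelChar μ₁ μ₂ (upper u v w) = μ₁ u * μ₂ v := by
  change μ₁ _ * μ₂ _ = _
  congr 2 <;> ext <;> simp [coe_upper]

theorem exists_eq_upper (b : borel F) : ∃ u v w, b = upper u v w := by
  refine ⟨Units.mk0 (b.1 0 0) (left_ne_zero_of_mul (borel_diag_mul b.2)),
    Units.mk0 (b.1 1 1) (right_ne_zero_of_mul (borel_diag_mul b.2)), b.1 0 1, ?_⟩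
  have h : b.1 1 0 = 0 := b.2
  ext i j
  rw [coe_upper]
  fin_cases i <;> fin_cases j <;> simp [h]

/-- The Weyl element `[[0, 1], [1, 0]]`. -/
def weyl : GL (Fin 2) F :=
  Matrix.GeneralLinearGroup.mkOfDetNeZero !![0, 1; 1, 0] (by simp [Matrix.det_fin_two])

theorem coe_weyl : ((weyl : GL (Fin 2) F) : Matrix (Fin 2) (Fin 2) F) = !![0, 1; 1, 0] :=
  rfl

theorem weyl_notMem_borel : (weyl : GL (Fin 2) F) ∉ borel F := by
  change ¬ (_ : F) = 0
  simp [coe_weyl]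

theorem exists_bruhat {x : GL (Fin 2) F} (hx : x ∉ borel F) :
    ∃ b b' : borel F, x = b.1 * (weyl : GL (Fin 2) F) * b'.1 := by
  have hc : x 1 0 ≠ 0 := hx
  have hd : x.det.1 ≠ 0 := x.det.ne_zero
  rw [Matrix.GeneralLinearGroup.val_det_apply, Matrix.det_fin_two] at hd
  -- For `x = [[a, b], [c, d]]`: the right factor clears `d` using `c ≠ 0`, and the left one is then
  -- forced, with diagonal `-det x / c`, `c`.
  refine ⟨upper (Units.mk0 (-(x 0 0 * x 1 1 - x 0 1 * x 1 0) / x 1 0)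
    (div_ne_zero (neg_ne_zero.2 hd) hc)) (Units.mk0 _ hc) (x 0 0),
    upper 1 1 (x 1 1 / x 1 0), ?_⟩
  ext i j
  simp only [Units.val_mul, coe_upper, coe_weyl]
  fin_cases i <;> fin_cases j <;> simp [Matrix.mul_apply, Fin.sum_univ_two] <;> field_simp
  ring

theorem upper_mul_weyl (u v : Fˣ) :
    ((upper u v (0 : F)).1 * weyl : GL (Fin 2) F) = weyl * (upper v u (0 : F)).1 := by
  ext i j
  simp only [Units.val_mul, coe_upper, coe_weyl]
  fin_cases i <;> fin_cases j <;> simp [Matrix.mul_apply, Fin.sum_univ_two]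

theorem upper_mul (u v u' v' : Fˣ) (w w' : F) :
    upper u v w * upper u' v' w' = upper (u * u') (v * v') (u * w' + w * v') := by
  ext i j
  simp only [Subgroup.coe_mul, Units.val_mul, coe_upper]
  fin_cases i <;> fin_cases j <;> simp [Matrix.mul_apply, Fin.sum_univ_two]

theorem upper_mem_mirabolic (v : Fˣ) (w : F) : (upper 1 v w).1 ∈ mirabolic F := by
  refine ⟨?_, ?_⟩ <;> simp [coe_upper]

theorem exists_eq_upper_of_mem_mirabolic (p : mirabolic F) :
    ∃ v w, p.1 = (upper 1 v w).1 := by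
  obtain ⟨u, v, w, h⟩ := exists_eq_upper ⟨p.1, p.2.2⟩
  have h' : p.1 = upper u v w := congrArg Subtype.val h
  have hu : u = 1 := by
    have := p.2.1
    rw [h', coe_upper] at this
    ext
    simpa using this
  exact ⟨v, w, by rw [h', hu]⟩

theorem scalar_mul_comm (u : Fˣ) (x : GL (Fin 2) F) :
    x * (upper u u (0 : F)).1 = (upper u u (0 : F)).1 * x := by
  ext i j
  simp only [Units.val_mul, coe_upper]
  fin_cases i <;> fin_cases j <;> simp [Matrix.mul_apply, Fin.sum_univ_two, mul_comm]

/-! ### Principal series: central character and irreducibility -/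

variable {μ₁ μ₂ : Fˣ →* ℂˣ}

theorem principalSeries_scalar (u : Fˣ)
    (f : coindV (borel F).subtype (charRep (borelChar μ₁ μ₂))) :
    principalSeries μ₁ μ₂ (upper u u 0 : borel F) f = ((μ₁ u * μ₂ u : ℂˣ) : ℂ) • f := by
  ext x
  rw [induced_apply, scalar_mul_comm, coindV_charRep_apply, borelChar_upper]
  rfl

theorem toRepresentation_scalar (W : Subrepresentation (principalSeries μ₁ μ₂)) (u : Fˣ)
    (w : W.toSubmodule) : W.toRepresentation (upper u u (0 : F)).1 w =
      ((μ₁ u * μ₂ u : ℂˣ) : ℂ) • w :=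
  Subtype.ext (principalSeries_scalar u w.1)

theorem exists_apply_ne {χ χ' : Fˣ →* ℂˣ} (h : χ ≠ χ') : ∃ a, χ a ≠ χ' a := by
  by_contra! hcon
  exact h (MonoidHom.ext hcon)

/-- Bi-equivariant elements of a principal series with distinct parameters are supported on the
Borel subgroup. -/
theorem biequivariant_weyl_eq_zero (hμ : μ₁ ≠ μ₂)
    (h : coindV (borel F).subtype (charRep (borelChar μ₁ μ₂)))
    (hh : ∀ x (b : borel F), h.1 (x * b) = borelChar μ₁ μ₂ b * h.1 x) : h.1 weyl = 0 := by
  obtain ⟨a, ha⟩ := exists_apply_ne hμ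
  -- Since diag(a, 1) times `weyl` is `weyl` times diag(1, a), the value at `weyl` is scaled both by
  -- `μ₁ a` and by `μ₂ a`.
  have h1 := coindV_charRep_apply h (upper a 1 0) weyl
  rw [upper_mul_weyl, hh, borelChar_upper, borelChar_upper, map_one, map_one, one_mul,
    mul_one] at h1
  by_contra h0
  exact ha (Units.ext (mul_right_cancel₀ h0 h1)).symm

theorem principalSeries_isIrreducible [Finite F] (hμ : μ₁ ≠ μ₂) :
    (principalSeries μ₁ μ₂).IsIrreducible where
  exists_pair_ne := by
    refine ⟨⊥, ⊤, fun h => extendChar_ne_zero (ψ := borelChar μ₁ μ₂) ?_⟩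
    have : extendChar (borelChar μ₁ μ₂) ∈ (⊤ : Subrepresentation (principalSeries μ₁ μ₂)) :=
      Submodule.mem_top
    rw [← h] at this
    exact this
  eq_bot_or_eq_top M := by
    refine or_iff_not_imp_left.2 fun hM => eq_top_of_extendChar_mem M ?_
    obtain ⟨h, hhM, h1, hb⟩ := exists_biequivariant_mem M hM
    convert hhM
    ext x
    by_cases hx : x ∈ borel F
    · have := hb 1 ⟨x, hx⟩
      rw [one_mul, h1, mul_one] at this
      rw [extendChar_of_mem hx, this]
    · obtain ⟨b, b', rfl⟩ := exists_bruhat hx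
      rw [extendChar_of_notMem hx, hb, coindV_charRep_apply,
        biequivariant_weyl_eq_zero hμ h hb]
      simp

/-! ### Constants in `ρ_{1,1}` and their complements -/

theorem borelChar_one : borelChar (1 : Fˣ →* ℂˣ) 1 = 1 := by
  ext b
  obtain ⟨u, v, w, rfl⟩ := exists_eq_upper b
  simp [borelChar_upper]

/-- Constant functions in `ρ_{1, 1}`. -/
def constMap : ℂ →ₗ[ℂ] coindV (borel F).subtype (charRep (borelChar (1 : Fˣ →* ℂˣ) 1)) where
  toFun c := ⟨fun _ => c, fun b x => by simp [charRep_apply, borelChar_one]⟩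
  map_add' _ _ := rfl
  map_smul' _ _ := rfl

@[simp]
theorem constMap_apply (c : ℂ) (x : GL (Fin 2) F) : (constMap c).1 x = c := rfl

theorem detRep_one_apply (g : GL (Fin 2) F) (z : ℂ) : detRep 1 g z = z := by
  simp [detRep, charRep_apply]

theorem eq_constMap_of_invariant
    (f : coindV (borel F).subtype (charRep (borelChar (1 : Fˣ →* ℂˣ) 1)))
    (hf : ∀ g, principalSeries 1 1 g f = f) : f = constMap (f.1 1) := by
  ext x
  have := congrFun (congrArg Subtype.val (hf x)) 1
  rw [induced_apply, one_mul] at this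
  simpa using this

/-- Invariant functions are constant because right translation is transitive. Hence the trivial
summand in `IsDetComplement 1` is always the same space, whatever `D` is chosen. -/
theorem toSubmodule_eq_range_constMap (D : Subrepresentation (principalSeries (1 : Fˣ →* ℂˣ) 1))
    (e : D.toRepresentation.Equiv (detRep 1)) : D.toSubmodule = LinearMap.range constMap := by
  have hc : ∀ d : D.toSubmodule, d.1 = constMap (d.1.1 1) := fun d => by
    apply eq_constMap_of_invariant
    intro g
    have h : D.toRepresentation g d = d := by
      apply e.toLinearEquiv.injective
      have := IntertwiningMap.isIntertwining _ _ e.toIntertwiningMap g d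
      rw [detRep_one_apply] at this
      exact this
    exact congrArg Subtype.val h
  apply le_antisymm
  · intro d hd
    exact ⟨_, (hc ⟨d, hd⟩).symm⟩
  · rintro _ ⟨c, rfl⟩
    set d := e.toLinearEquiv.symm 1
    have hd0 : d.1.1 1 ≠ 0 := by
      intro h0
      have h := hc d
      rw [h0, map_zero] at h
      exact one_ne_zero ((e.toLinearEquiv.symm.map_eq_zero_iff).1 (Subtype.ext h))
    have : constMap c = (c / d.1.1 1) • d.1 := by
      rw [hc d]
      ext x
      simp [hd0]
    rw [this]
    exact D.toSubmodule.smul_mem _ d.2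

variable (F) in
/-- The subrepresentation of constant functions in `ρ_{1, 1}`. -/
def constSub : Subrepresentation (principalSeries (1 : Fˣ →* ℂˣ) 1) where
  toSubmodule := LinearMap.range constMap
  apply_mem_toSubmodule := by
    rintro g _ ⟨c, rfl⟩
    exact ⟨c, rfl⟩

theorem constMap_injective : Function.Injective (constMap (F := F)) := fun a b h => by
  simpa using congrFun (congrArg Subtype.val h) 1

variable (F) in
/-- The constant functions form the trivial representation. -/
def constSubEquiv : (constSub F).toRepresentation.Equiv (detRep 1) :=
  (Representation.Equiv.mk (LinearEquiv.ofInjective constMap constMap_injective) (fun g => by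
    ext
    rw [LinearMap.comp_apply, LinearMap.comp_apply, detRep_one_apply]
    rfl) : (detRep 1).Equiv (constSub F).toRepresentation).symm

variable (F) in
/-- The subrepresentation of functions with vanishing sum in `ρ_{1, 1}`. -/
def sumZeroSub [Fintype (GL (Fin 2) F)] :
    Subrepresentation (principalSeries (1 : Fˣ →* ℂˣ) 1) where
  toSubmodule :=
    { carrier := {f | ∑ x, f.1 x = 0}
      add_mem' := fun {a b} ha hb => by
        simp only [Set.mem_ofPred_eq] at ha hb ⊢
        simp [Finset.sum_add_distrib, ha, hb]
      zero_mem' := by simp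
      smul_mem' := fun c a ha => by
        simp only [Set.mem_ofPred_eq] at ha ⊢
        simp [← Finset.mul_sum, ha] }
  apply_mem_toSubmodule g f hf := by
    change ∑ x, f.1 (x * g) = 0
    rw [← hf]
    exact Equiv.sum_comp (Equiv.mulRight g) f.1

theorem exists_isDetComplement_one [Finite F] :
    ∃ W : Subrepresentation (principalSeries (1 : Fˣ →* ℂˣ) 1), IsDetComplement 1 W := by
  have := Fintype.ofFinite (GL (Fin 2) F)
  have hc : (Fintype.card (GL (Fin 2) F) : ℂ) ≠ 0 := by
    exact_mod_cast Fintype.card_ne_zero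
  refine ⟨sumZeroSub F, constSub F, ⟨constSubEquiv F⟩, ?_⟩
  rw [isCompl_iff, disjoint_iff, codisjoint_iff]
  constructor
  · apply Subrepresentation.toSubmodule_injective
    refine (Submodule.eq_bot_iff _).2 ?_
    rintro _ ⟨⟨c, rfl⟩, h⟩
    change ∑ x : GL (Fin 2) F, c = 0 at h
    rw [Finset.sum_const, Finset.card_univ, nsmul_eq_mul] at h
    rw [(mul_eq_zero.1 h).resolve_left hc, map_zero]
  · rw [eq_top_iff]
    intro f _
    -- Split `f` into its mean value and the remainder, which has sum zero.
    refine Submodule.mem_sup.2 ⟨constMap ((Fintype.card (GL (Fin 2) F) : ℂ)⁻¹ * ∑ x, f.1 x),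
      ⟨_, rfl⟩, f - constMap ((Fintype.card (GL (Fin 2) F) : ℂ)⁻¹ * ∑ x, f.1 x), ?_, by simp⟩
    change ∑ x, (f.1 x - _) = 0
    simp [Finset.sum_sub_distrib, hc]

variable {W : Subrepresentation (principalSeries (1 : Fˣ →* ℂˣ) 1)}

theorem IsDetComplement.isCompl_constSub (hW : IsDetComplement 1 W) :
    IsCompl (constSub F) W := by
  obtain ⟨D, ⟨e⟩, h⟩ := hW
  have : D = constSub F :=
    Subrepresentation.toSubmodule_injective (toSubmodule_eq_range_constMap D e)
  rwa [← this]

theorem IsDetComplement.eq_zero_of_constMap_mem (hW : IsDetComplement 1 W) {c : ℂ}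
    (hc : constMap c ∈ W.toSubmodule) : c = 0 := by
  have h := hW.isCompl_constSub.inf_eq_bot
  have : constMap c ∈ (constSub F ⊓ W).toSubmodule := ⟨⟨c, rfl⟩, hc⟩
  rw [h] at this
  exact constMap_injective (((Submodule.mem_bot ℂ).1 this).trans (map_zero _).symm)

theorem IsDetComplement.ne_bot (hW : IsDetComplement 1 W) : W ≠ ⊥ := by
  rintro rfl
  have h := hW.isCompl_constSub.sup_eq_top
  rw [sup_bot_eq] at h
  have : extendChar (borelChar (1 : Fˣ →* ℂˣ) 1) ∈ (constSub F).toSubmodule := by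
    rw [h]
    exact Submodule.mem_top
  obtain ⟨c, hc⟩ := this
  have h1 := congrFun (congrArg Subtype.val hc) 1
  have h2 := congrFun (congrArg Subtype.val hc) weyl
  rw [extendChar_one, constMap_apply] at h1
  rw [extendChar_of_notMem weyl_notMem_borel, constMap_apply] at h2
  simp [h1] at h2

/-- A biequivariant `h ∈ M` is a constant plus a multiple of `extendChar`; the multiple is nonzero
since `W` has no nonzero constants. So `M` and the constants generate everything, and `M` fills the
complement `W`. -/
theorem IsDetComplement.eq_of_le [Finite F] (hW : IsDetComplement 1 W)
    {M : Subrepresentation (principalSeries (1 : Fˣ →* ℂˣ) 1)} (hM : M ≠ ⊥) (hMW : M ≤ W) :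
    M = W := by
  obtain ⟨h, hhM, h1, hb⟩ := exists_biequivariant_mem M hM
  simp only [borelChar_one, MonoidHom.one_apply, Units.val_one, one_mul] at hb
  have hval : h = constMap (h.1 weyl) + (1 - h.1 weyl) • extendChar (borelChar 1 1) := by
    ext x
    change h.1 x = h.1 weyl + (1 - h.1 weyl) * (extendChar (borelChar (1 : Fˣ →* ℂˣ) 1)).1 x
    by_cases hx : x ∈ borel F
    · have := hb 1 ⟨x, hx⟩
      rw [one_mul, h1] at this
      rw [extendChar_of_mem hx, this]
      simp [borelChar_one]
    · obtain ⟨b, b', rfl⟩ := exists_bruhat hx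
      rw [extendChar_of_notMem hx, hb, coindV_charRep_apply]
      simp [borelChar_one]
  have hne : 1 - h.1 weyl ≠ 0 := by
    intro h0
    rw [h0, zero_smul, add_zero] at hval
    have := hW.eq_zero_of_constMap_mem (c := h.1 weyl) (hval ▸ hMW hhM)
    simp [this] at h0
  have htop : M ⊔ constSub F = ⊤ := by
    apply eq_top_of_extendChar_mem
    have : extendChar (borelChar (1 : Fˣ →* ℂˣ) 1) =
        (1 - h.1 weyl)⁻¹ • (h + constMap (-h.1 weyl)) := by
      rw [eq_inv_smul_iff₀ hne, map_neg, ← sub_eq_add_neg, eq_sub_iff_add_eq, add_comm]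
      exact hval.symm
    rw [this]
    exact Submodule.smul_mem _ _ (Submodule.add_mem_sup hhM ⟨_, rfl⟩)
  apply le_antisymm hMW
  intro w hw
  have : w ∈ (M ⊔ constSub F).toSubmodule := by
    rw [htop]
    exact Submodule.mem_top
  obtain ⟨m, hm, _, ⟨c, rfl⟩, rfl⟩ := Submodule.mem_sup.1 this
  have hc : constMap c ∈ W.toSubmodule := by
    have := W.toSubmodule.sub_mem hw (hMW hm)
    rwa [add_sub_cancel_left] at this
  rw [hW.eq_zero_of_constMap_mem hc, map_zero, add_zero]
  exact hm

theorem IsDetComplement.isIrreducible [Finite F] (hW : IsDetComplement 1 W) :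
    IsIrreducible (k := ℂ) (V := W.toSubmodule) W.toRepresentation where
  exists_pair_ne := by
    refine ⟨⊥, ⊤, fun h => hW.ne_bot ?_⟩
    apply Subrepresentation.toSubmodule_injective
    refine (Submodule.eq_bot_iff _).2 fun w hw => ?_
    have : (⟨w, hw⟩ : W.toSubmodule) ∈ (⊤ : Subrepresentation W.toRepresentation) :=
      Submodule.mem_top
    rw [← h] at this
    exact congrArg Subtype.val ((Submodule.mem_bot ℂ).1 this)
  eq_bot_or_eq_top N := by
    -- View `N` inside `ρ_{1,1}`, where `eq_of_le` applies.
    let M : Subrepresentation (principalSeries (1 : Fˣ →* ℂˣ) 1) :=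
      { toSubmodule := N.toSubmodule.map W.toSubmodule.subtype
        apply_mem_toSubmodule := by
          rintro g _ ⟨w, hw, rfl⟩
          exact ⟨_, N.apply_mem_toSubmodule g hw, rfl⟩ }
    by_cases hM : M = ⊥
    · left
      apply Subrepresentation.toSubmodule_injective
      refine (Submodule.eq_bot_iff _).2 fun w hw => Subtype.ext ?_
      have : w.1 ∈ M.toSubmodule := ⟨w, hw, rfl⟩
      rw [hM] at this
      exact (Submodule.mem_bot ℂ).1 this
    · right
      have hMW : M ≤ W := by
        rintro _ ⟨w, _, rfl⟩
        exact w.2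
      rw [eq_top_iff]
      intro w _
      have : w.1 ∈ M.toSubmodule := by
        rw [hW.eq_of_le hM hMW]
        exact w.2
      obtain ⟨w', hw', he⟩ := this
      rwa [← Subtype.ext he]

/-! ### The trivial representation and inequivalence criteria -/

theorem trivial_isIrreducible {G : Type*} [Group G] :
    (Representation.trivial ℂ G ℂ).IsIrreducible where
  exists_pair_ne := by
    refine ⟨⊥, ⊤, fun h => one_ne_zero (α := ℂ) ?_⟩
    have : (1 : ℂ) ∈ (⊤ : Subrepresentation (Representation.trivial ℂ G ℂ)) := Submodule.mem_top
    rw [← h] at this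
    exact this
  eq_bot_or_eq_top M := (eq_bot_or_eq_top M.toSubmodule).imp
    (fun h => Subrepresentation.toSubmodule_injective h)
    (fun h => Subrepresentation.toSubmodule_injective h)

/-- A nonzero representation on which a central element acts by one scalar is not equivalent to
one on which it acts by another. -/
theorem isEmpty_equiv_of_scalar_ne {G V V' : Type*} [Group G] [AddCommGroup V] [Module ℂ V]
    [AddCommGroup V'] [Module ℂ V'] {ρ : Representation ℂ G V} {ρ' : Representation ℂ G V'}
    (g : G) {c c' : ℂ} (hc : ∀ v, ρ g v = c • v) (hc' : ∀ v, ρ' g v = c' • v) (h : c ≠ c')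
    {v' : V'} (hv' : v' ≠ 0) : IsEmpty (ρ.Equiv ρ') := by
  refine ⟨fun e => ?_⟩
  have h1 := IntertwiningMap.isIntertwining _ _ e.toIntertwiningMap g (e.toLinearEquiv.symm v')
  have h2 : e.toIntertwiningMap (e.toLinearEquiv.symm v') = v' :=
    e.toLinearEquiv.apply_symm_apply v'
  rw [hc, map_smul, h2, hc', ← sub_eq_zero, ← sub_smul, smul_eq_zero, sub_eq_zero] at h1
  exact h1.elim h hv'

theorem IsDetComplement.isEmpty_trivial_equiv (hW : IsDetComplement 1 W) :
    IsEmpty ((Representation.trivial ℂ (GL (Fin 2) F) ℂ).Equiv W.toRepresentation) := by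
  refine ⟨fun e => hW.ne_bot ?_⟩
  apply Subrepresentation.toSubmodule_injective
  refine (Submodule.eq_bot_iff _).2 fun w hw => ?_
  have hinv : ∀ g, principalSeries 1 1 g w = w := by
    intro g
    have h1 := IntertwiningMap.isIntertwining _ _ e.toIntertwiningMap g
      (e.toLinearEquiv.symm ⟨w, hw⟩)
    have h2 : e.toIntertwiningMap (e.toLinearEquiv.symm ⟨w, hw⟩) = ⟨w, hw⟩ :=
      e.toLinearEquiv.apply_symm_apply _
    rw [Representation.trivial_apply, h2] at h1
    exact (congrArg Subtype.val h1).symm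
  have := eq_constMap_of_invariant w hinv
  rw [this] at hw
  rw [this, hW.eq_zero_of_constMap_mem hw, map_zero]

/-! ### Decomposition of `Ind_P^G 1` by Fourier analysis on `Fˣ` -/

/-- The inclusion of `ρ_{χ, 1}` into `Ind_P^G 1`. -/
def inclMirabolic (χ : Fˣ →* ℂˣ) :
    coindV (borel F).subtype (charRep (borelChar χ 1)) →ₗ[ℂ]
      coindV (mirabolic F).subtype (Representation.trivial ℂ (mirabolic F) ℂ) where
  toFun f := ⟨f.1, fun p x => by
    -- The underlying function is unchanged: the character `(χ, 1)` of `B` is trivial on `P`.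
    obtain ⟨v, w, h⟩ := exists_eq_upper_of_mem_mirabolic p
    rw [Subgroup.subtype_apply, h, coindV_charRep_apply, borelChar_upper]
    simp⟩
  map_add' _ _ := rfl
  map_smul' _ _ := rfl

theorem coindV_mirabolic_upper
    (f : coindV (mirabolic F).subtype (Representation.trivial ℂ (mirabolic F) ℂ))
    (u v : Fˣ) (w : F) (x : GL (Fin 2) F) :
    f.1 (upper u v w * x) = f.1 (upper u 1 0 * x) := by
  have h : (upper u v w : GL (Fin 2) F) = upper 1 v w * upper u 1 0 := by
    rw [← Subgroup.coe_mul, upper_mul]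
    simp
  rw [h, mul_assoc]
  exact coindV_trivial_apply f ⟨_, upper_mem_mirabolic v w⟩ _

/-- The projection of `Ind_P^G 1` onto `ρ_{χ, 1}`. -/
def projMirabolic [Fintype Fˣ] (χ : Fˣ →* ℂˣ) :
    coindV (mirabolic F).subtype (Representation.trivial ℂ (mirabolic F) ℂ) →ₗ[ℂ]
      coindV (borel F).subtype (charRep (borelChar χ 1)) where
  toFun f := ⟨fun x => (Fintype.card Fˣ : ℂ)⁻¹ *
      ∑ a : Fˣ, ((χ a)⁻¹ : ℂ) * f.1 (upper a 1 0 * x), fun b x => by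
    obtain ⟨u, v, w, rfl⟩ := exists_eq_upper b
    rw [charRep_apply, borelChar_upper, mul_left_comm]
    beta_reduce
    congr 1
    rw [Finset.mul_sum]
    -- The shift `a ↦ a * u` produces the factor `χ u`; the entries `v` and `w` are absorbed by
    -- `P`-invariance.
    refine Fintype.sum_equiv (Equiv.mulRight u) _ _ fun a => ?_
    rw [Subgroup.subtype_apply, ← mul_assoc, ← Subgroup.coe_mul, upper_mul,
      coindV_mirabolic_upper]
    simp [← mul_assoc]⟩
  map_add' f g := by
    ext x
    simp [mul_add, Finset.sum_add_distrib]
  map_smul' c f := by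
    ext x
    simp [mul_left_comm, Finset.mul_sum]

theorem projMirabolic_apply [Fintype Fˣ] (χ : Fˣ →* ℂˣ)
    (f : coindV (mirabolic F).subtype (Representation.trivial ℂ (mirabolic F) ℂ))
    (x : GL (Fin 2) F) : (projMirabolic χ f).1 x = (Fintype.card Fˣ : ℂ)⁻¹ *
      ∑ a : Fˣ, ((χ a)⁻¹ : ℂ) * f.1 (upper a 1 0 * x) := rfl

theorem projMirabolic_inclMirabolic_self [Fintype Fˣ] (χ : Fˣ →* ℂˣ)
    (f : coindV (borel F).subtype (charRep (borelChar χ 1))) :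
    projMirabolic χ (inclMirabolic χ f) = f := by
  ext x
  have hc : (Fintype.card Fˣ : ℂ) ≠ 0 := by
    exact_mod_cast Fintype.card_ne_zero
  rw [projMirabolic_apply]
  have : ∀ a : Fˣ, ((χ a)⁻¹ : ℂ) * (inclMirabolic χ f).1 (upper a 1 0 * x) = f.1 x := by
    intro a
    change _ * f.1 _ = _
    rw [coindV_charRep_apply, borelChar_upper]
    simp
  simp [this, hc]

theorem projMirabolic_inclMirabolic_of_ne [Fintype Fˣ] {χ χ' : Fˣ →* ℂˣ} (h : χ ≠ χ')
    (f : coindV (borel F).subtype (charRep (borelChar χ' 1))) :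
    projMirabolic χ (inclMirabolic χ' f) = 0 := by
  ext x
  rw [projMirabolic_apply]
  have : ∀ a : Fˣ, ((χ a)⁻¹ : ℂ) * (inclMirabolic χ' f).1 (upper a 1 0 * x) =
      (Units.coeHom ℂ).comp (χ⁻¹ * χ') a * f.1 x := by
    intro a
    change _ * f.1 _ = _
    rw [coindV_charRep_apply, borelChar_upper]
    simp [mul_assoc]
  rw [Finset.sum_congr rfl fun a _ => this a, ← Finset.sum_mul, sum_hom_units_eq_zero]
  · simp
  · intro h1
    apply h
    ext a
    have := DFunLike.congr_fun h1 a
    simp only [MonoidHom.comp_apply, Units.coeHom_apply, MonoidHom.one_apply,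
      Units.val_eq_one, MonoidHom.mul_apply, MonoidHom.inv_apply, inv_mul_eq_one] at this
    rw [this]

/-- Fourier inversion: after exchanging the sums, summing `(χ a)⁻¹` over all `χ` leaves only the
term `a = 1`. -/
theorem sum_inclMirabolic_projMirabolic [Fintype Fˣ] [Fintype (Fˣ →* ℂˣ)]
    (f : coindV (mirabolic F).subtype (Representation.trivial ℂ (mirabolic F) ℂ)) :
    ∑ χ, inclMirabolic χ (projMirabolic χ f) = f := by
  classical
  ext x
  have hc : (Fintype.card Fˣ : ℂ) ≠ 0 := by
    exact_mod_cast Fintype.card_ne_zero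
  rw [Submodule.coe_sum, Finset.sum_apply]
  change ∑ χ : Fˣ →* ℂˣ, (Fintype.card Fˣ : ℂ)⁻¹ *
    ∑ a : Fˣ, ((χ a)⁻¹ : ℂ) * f.1 (upper a 1 0 * x) = f.1 x
  rw [← Finset.mul_sum, Finset.sum_comm]
  have h : ∀ a : Fˣ, ∑ χ : Fˣ →* ℂˣ, ((χ a)⁻¹ : ℂ) = if a = 1 then (Fintype.card Fˣ : ℂ) else 0 := by
    intro a
    have := sum_monoidHom_units_eq a⁻¹
    simpa [Nat.card_eq_fintype_card] using this
  have h1 : ((upper 1 1 0 : borel F) : GL (Fin 2) F) = 1 := by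
    ext i j
    rw [coe_upper]
    fin_cases i <;> fin_cases j <;> simp
  simp [← Finset.sum_mul, h, h1, hc]

/-- The sum map from the direct sum decomposition to `Ind_P^G 1`. -/
def decompMap [DecidableEq {χ : Fˣ →* ℂˣ // χ ≠ 1}]
    (W : Subrepresentation (principalSeries (1 : Fˣ →* ℂˣ) 1)) :
    (ℂ × (W.toSubmodule × DirectSum {χ : Fˣ →* ℂˣ // χ ≠ 1}
      fun χ => coindV (borel F).subtype (charRep (borelChar χ.1 1)))) →ₗ[ℂ]
      coindV (mirabolic F).subtype (Representation.trivial ℂ (mirabolic F) ℂ) :=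
  (inclMirabolic 1 ∘ₗ constMap).coprod ((inclMirabolic 1 ∘ₗ W.toSubmodule.subtype).coprod
    (DirectSum.toModule ℂ _ _ fun χ => inclMirabolic χ.1))

theorem projMirabolic_toModule [Fintype Fˣ] [DecidableEq {χ : Fˣ →* ℂˣ // χ ≠ 1}]
    [DecidableEq (Fˣ →* ℂˣ)] (χ : Fˣ →* ℂˣ)
    (s : DirectSum {χ : Fˣ →* ℂˣ // χ ≠ 1}
      fun χ => coindV (borel F).subtype (charRep (borelChar χ.1 1))) :
    projMirabolic χ (DirectSum.toModule ℂ _ _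
      (fun χ : {χ : Fˣ →* ℂˣ // χ ≠ 1} => inclMirabolic χ.1) s) =
      if h : χ ≠ 1 then s ⟨χ, h⟩ else 0 := by
  induction s using DirectSum.induction_on with
  | zero => simp
  | of i f =>
    rw [← DirectSum.lof_eq_of ℂ, DirectSum.toModule_lof]
    by_cases hi : χ = i
    · subst hi
      rw [projMirabolic_inclMirabolic_self, dif_pos i.2, DirectSum.lof_apply]
    · rw [projMirabolic_inclMirabolic_of_ne hi]
      split_ifs with h
      · rw [DirectSum.lof_eq_of, DirectSum.of_eq_of_ne _ _ _ fun h' => hi (congrArg Subtype.val h')]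
      · rfl
  | add a b ha hb =>
    rw [map_add, map_add, ha, hb]
    split_ifs <;> simp

theorem decompMap_apply [DecidableEq {χ : Fˣ →* ℂˣ // χ ≠ 1}] (c : ℂ) (w : W.toSubmodule)
    (s : DirectSum {χ : Fˣ →* ℂˣ // χ ≠ 1}
      fun χ => coindV (borel F).subtype (charRep (borelChar χ.1 1))) :
    decompMap W (c, w, s) = inclMirabolic 1 (constMap c) + (inclMirabolic 1 w.1 +
      DirectSum.toModule ℂ _ _
        (fun χ : {χ : Fˣ →* ℂˣ // χ ≠ 1} => inclMirabolic χ.1) s) :=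
  rfl

/-- The projections isolate each `χ ≠ 1` component, and the projection for `χ = 1` leaves `c + w =
0`, where constants and `W` are independent. -/
theorem decompMap_injective [Finite F] [DecidableEq {χ : Fˣ →* ℂˣ // χ ≠ 1}]
    (hW : IsDetComplement 1 W) :
    Function.Injective (decompMap W) := by
  classical
  have := Fintype.ofFinite Fˣ
  rw [injective_iff_map_eq_zero]
  rintro ⟨c, w, s⟩ h
  rw [decompMap_apply] at h
  have hs : s = 0 := by
    ext1 χ
    have := congrArg (projMirabolic χ.1) h
    rw [map_add, map_add, projMirabolic_inclMirabolic_of_ne χ.2,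
      projMirabolic_inclMirabolic_of_ne χ.2, projMirabolic_toModule, dif_pos χ.2, zero_add,
      zero_add, map_zero] at this
    exact this
  have hcw : constMap (F := F) c + w.1 = 0 := by
    have := congrArg (projMirabolic 1) h
    rwa [hs, map_zero, add_zero, map_add, projMirabolic_inclMirabolic_self,
      projMirabolic_inclMirabolic_self, map_zero] at this
  have hc : c = 0 := by
    apply hW.eq_zero_of_constMap_mem
    rw [eq_neg_of_add_eq_zero_left hcw]
    exact W.toSubmodule.neg_mem w.2
  rw [hc, map_zero, zero_add] at hcw
  have hw : w = 0 := Subtype.ext hcw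
  rw [hc, hs, hw]
  rfl

theorem decompMap_surjective [Finite F] [DecidableEq {χ : Fˣ →* ℂˣ // χ ≠ 1}]
    (hW : IsDetComplement 1 W) :
    Function.Surjective (decompMap W) := by
  classical
  have := Fintype.ofFinite Fˣ
  have : Fintype (Fˣ →* ℂˣ) := Fintype.ofFinite _
  intro f
  rw [← LinearMap.mem_range, ← sum_inclMirabolic_projMirabolic f]
  refine Submodule.sum_mem _ fun χ _ => ?_
  generalize projMirabolic χ f = k
  by_cases hχ : χ = 1
  · subst hχ
    have : k ∈ (constSub F ⊔ W).toSubmodule := by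
      rw [hW.isCompl_constSub.sup_eq_top]
      exact Submodule.mem_top
    obtain ⟨_, ⟨c, rfl⟩, w, hw, rfl⟩ := Submodule.mem_sup.1 this
    refine ⟨(c, ⟨w, hw⟩, 0), ?_⟩
    rw [decompMap_apply, map_zero, add_zero, map_add]
  · refine ⟨(0, 0, DirectSum.lof ℂ {χ : Fˣ →* ℂˣ // χ ≠ 1}
      (fun χ => coindV (borel F).subtype (charRep (borelChar χ.1 1))) ⟨χ, hχ⟩ k), ?_⟩
    simp only [decompMap, LinearMap.coprod_apply, map_zero, zero_add, DirectSum.toModule_lof]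

theorem inclMirabolic_principalSeries (χ : Fˣ →* ℂˣ) (g : GL (Fin 2) F)
    (f : coindV (borel F).subtype (charRep (borelChar χ 1))) :
    inclMirabolic χ (principalSeries χ 1 g f) =
      induced (mirabolic F) (Representation.trivial ℂ (mirabolic F) ℂ) g (inclMirabolic χ f) :=
  rfl

theorem toModule_inclMirabolic_directSum [DecidableEq {χ : Fˣ →* ℂˣ // χ ≠ 1}]
    (g : GL (Fin 2) F) :
    DirectSum.toModule ℂ _ _ (fun χ : {χ : Fˣ →* ℂˣ // χ ≠ 1} => inclMirabolic χ.1) ∘ₗ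
        Representation.directSum
          (fun χ : {χ : Fˣ →* ℂˣ // χ ≠ 1} => principalSeries χ.1 1) g =
      induced (mirabolic F) (Representation.trivial ℂ (mirabolic F) ℂ) g ∘ₗ
        DirectSum.toModule ℂ _ _
          (fun χ : {χ : Fˣ →* ℂˣ // χ ≠ 1} => inclMirabolic χ.1) := by
  refine DirectSum.linearMap_ext _ fun χ => LinearMap.ext fun f => ?_
  simp only [LinearMap.comp_apply, Representation.directSum_apply, DirectSum.lmap_lof,
    DirectSum.toModule_lof]
  exact inclMirabolic_principalSeries χ.1 g f

theorem decompMap_isIntertwining [DecidableEq {χ : Fˣ →* ℂˣ // χ ≠ 1}] (g : GL (Fin 2) F) :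
    decompMap W ∘ₗ ((Representation.trivial ℂ (GL (Fin 2) F) ℂ).prod
      (W.toRepresentation.prod (Representation.directSum
        (fun χ : {χ : Fˣ →* ℂˣ // χ ≠ 1} => principalSeries χ.1 1)))) g =
      induced (mirabolic F) (Representation.trivial ℂ (mirabolic F) ℂ) g ∘ₗ decompMap W := by
  refine LinearMap.ext fun ⟨c, w, s⟩ => ?_
  have h := LinearMap.congr_fun (toModule_inclMirabolic_directSum g) s
  rw [LinearMap.comp_apply, LinearMap.comp_apply] at h
  have hl : ((Representation.trivial ℂ (GL (Fin 2) F) ℂ).prod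
      (W.toRepresentation.prod (Representation.directSum
        (fun χ : {χ : Fˣ →* ℂˣ // χ ≠ 1} => principalSeries χ.1 1)))) g (c, w, s) =
      (c, W.toRepresentation g w, Representation.directSum
        (fun χ : {χ : Fˣ →* ℂˣ // χ ≠ 1} => principalSeries χ.1 1) g s) := rfl
  have hw : (W.toRepresentation g w).1 = principalSeries 1 1 g w.1 := rfl
  rw [LinearMap.comp_apply, LinearMap.comp_apply, hl, decompMap_apply, decompMap_apply,
    LinearMap.map_add, LinearMap.map_add, h, hw, inclMirabolic_principalSeries]
  rfl

end GeneralLinear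

end

end GLTwo

theorem proposition5p1 {F : Type*} [Field F] [Finite F] :
    (∃ W : Subrepresentation (GLTwo.principalSeries (1 : Fˣ →* ℂˣ) 1),
      GLTwo.IsDetComplement 1 W) ∧
    ∀ W : Subrepresentation (GLTwo.principalSeries (1 : Fˣ →* ℂˣ) 1),
      GLTwo.IsDetComplement 1 W →
      -- the listed representations are irreducible
      (Representation.trivial ℂ (GL (Fin 2) F) ℂ).IsIrreducible ∧
      Representation.IsIrreducible (k := ℂ) (V := W.toSubmodule) W.toRepresentation ∧
      (∀ χ : Fˣ →* ℂˣ, χ ≠ 1 → (GLTwo.principalSeries χ 1).IsIrreducible) ∧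
      -- they are pairwise inequivalent
      IsEmpty ((Representation.trivial ℂ (GL (Fin 2) F) ℂ).Equiv W.toRepresentation) ∧
      (∀ χ : Fˣ →* ℂˣ, χ ≠ 1 → IsEmpty
        ((Representation.trivial ℂ (GL (Fin 2) F) ℂ).Equiv (GLTwo.principalSeries χ 1))) ∧
      (∀ χ : Fˣ →* ℂˣ, χ ≠ 1 → IsEmpty
        (W.toRepresentation.Equiv (GLTwo.principalSeries χ 1))) ∧
      (∀ χ χ' : Fˣ →* ℂˣ, χ ≠ 1 → χ' ≠ 1 → χ ≠ χ' → IsEmpty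
        ((GLTwo.principalSeries χ 1).Equiv (GLTwo.principalSeries χ' 1))) ∧
      -- the induced representation is isomorphic to their direct sum
      Nonempty
        ((GLTwo.induced (GLTwo.mirabolic F)
            (Representation.trivial ℂ (GLTwo.mirabolic F) ℂ)).Equiv
          ((Representation.trivial ℂ (GL (Fin 2) F) ℂ).prod
            (W.toRepresentation.prod
              (Representation.directSum
                (fun χ : {χ : Fˣ →* ℂˣ // χ ≠ 1} => GLTwo.principalSeries χ.1 1))))) := by
  classical
  refine ⟨GLTwo.exists_isDetComplement_one, fun W hW => ⟨GLTwo.trivial_isIrreducible,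
    hW.isIrreducible, fun χ hχ => GLTwo.principalSeries_isIrreducible hχ,
    hW.isEmpty_trivial_equiv, fun χ hχ => ?_, fun χ hχ => ?_, fun χ χ' hχ hχ' h => ?_,
    ⟨(Representation.Equiv.mk (LinearEquiv.ofBijective (GLTwo.decompMap W)
      ⟨GLTwo.decompMap_injective hW, GLTwo.decompMap_surjective hW⟩)
      GLTwo.decompMap_isIntertwining).symm⟩⟩⟩
  -- In all three remaining cases, a scalar matrix on which the central characters differ separates
  -- the representations.
  · obtain ⟨a, ha⟩ := GLTwo.exists_apply_ne hχ.symm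
    refine GLTwo.isEmpty_equiv_of_scalar_ne (GLTwo.upper a a (0 : F)).1 (c := 1)
      (fun v => (one_smul _ _).symm) (GLTwo.principalSeries_scalar a) ?_
      GLTwo.extendChar_ne_zero
    simpa [Units.ext_iff] using ha
  · obtain ⟨a, ha⟩ := GLTwo.exists_apply_ne hχ.symm
    refine GLTwo.isEmpty_equiv_of_scalar_ne (GLTwo.upper a a (0 : F)).1
      (V := W.toSubmodule) (ρ := W.toRepresentation) (GLTwo.toRepresentation_scalar W a)
      (GLTwo.principalSeries_scalar a) ?_ GLTwo.extendChar_ne_zero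
    simpa [Units.ext_iff] using ha
  · obtain ⟨a, ha⟩ := GLTwo.exists_apply_ne h
    refine GLTwo.isEmpty_equiv_of_scalar_ne (GLTwo.upper a a (0 : F)).1
      (GLTwo.principalSeries_scalar a) (GLTwo.principalSeries_scalar a) ?_
      GLTwo.extendChar_ne_zero
    simpa [Units.ext_iff] using ha
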